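/- Let $k \ge 1$ be an integer and let $G$ be a finite simple graph that is outer min-$k$-planar, that is, $G$ admits a drawing in which the vertices are placed on different points of a circle, the edges are drawn as straight-line segments, and, for every pair of crossing edges, at least one of the two edges is crossed by at most $k$ edges of $G$. (Two different edges cross if their segments share a point that is an interior point of both.) Then the treewidth of $G$ is at most $3k+1$, that is, $G$ has a tree decomposition all of whose bags contain at most $3k+2$ vertices. -/

import Mathlib

namespace ConvexGraphDrawing

/-- A tree decomposition of a graph `G`: a finite tree whose nodes carry bags of vertices such that
every vertex and every edge is covered by some bag and, for every vertex `v`, the nodes whose bags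
contain `v` induce a (connected) subtree. -/
structure TreeDecomposition {V : Type*} (G : SimpleGraph V) where
  Node : Type
  finite_node : Finite Node
  tree : SimpleGraph Node
  isTree : tree.IsTree
  bag : Node → Set V
  vertex_cover : ∀ v : V, ∃ i : Node, v ∈ bag i
  edge_cover : ∀ u v : V, G.Adj u v → ∃ i : Node, u ∈ bag i ∧ v ∈ bag i
  subtree : ∀ v : V, (tree.induce {i : Node | v ∈ bag i}).Connected

/-- The width: the maximum size of a bag, minus one. -/
noncomputable def TreeDecomposition.width {V : Type*} {G : SimpleGraph V}
    (D : TreeDecomposition G) : ℕ∞ :=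
  (⨆ i : D.Node, (D.bag i).encard) - 1

/-- The treewidth: the minimum width over all tree decompositions. -/
noncomputable def treewidth {V : Type*} (G : SimpleGraph V) : ℕ∞ :=
  ⨅ D : TreeDecomposition G, D.width

/-- The data of a convex drawing of a graph on `V`: the vertices are placed on different points of a
circle in the Euclidean plane. Edges are drawn as straight-line segments (see `edgeInterior`). -/
structure ConvexDrawing (V : Type*) where
  center : EuclideanSpace ℝ (Fin 2)
  radius : ℝ
  radius_pos : 0 < radius
  pos : V → EuclideanSpace ℝ (Fin 2)
  pos_injective : Function.Injective pos
  pos_mem : ∀ v : V, pos v ∈ Metric.sphere center radius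

/-- The straight-line segment that represents an edge, without its two endpoints. -/
def ConvexDrawing.edgeInterior {V : Type*} (Γ : ConvexDrawing V) :
    Sym2 V → Set (EuclideanSpace ℝ (Fin 2)) :=
  Sym2.lift ⟨fun u v => openSegment ℝ (Γ.pos u) (Γ.pos v),
    fun u v => openSegment_symm ℝ (Γ.pos u) (Γ.pos v)⟩

/-- Two edges cross if they are different and share an interior point. -/
def ConvexDrawing.Cross {V : Type*} (Γ : ConvexDrawing V) (e f : Sym2 V) : Prop :=
  e ≠ f ∧ (Γ.edgeInterior e ∩ Γ.edgeInterior f).Nonempty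

/-- The number of crossings of `e` with edges of `G`. -/
noncomputable def ConvexDrawing.crossings {V : Type*} (Γ : ConvexDrawing V) (G : SimpleGraph V)
    (e : Sym2 V) : ℕ∞ :=
  {f : Sym2 V | f ∈ G.edgeSet ∧ Γ.Cross e f}.encard

/-- `G` admits a convex drawing in which, for every pair of crossing edges, at least one of the two
has at most `k` crossings. -/
def IsOuterMinPlanar {V : Type*} (k : ℕ) (G : SimpleGraph V) : Prop :=
  ∃ Γ : ConvexDrawing V, ∀ e ∈ G.edgeSet, ∀ f ∈ G.edgeSet, Γ.Cross e f →
    Γ.crossings G e ≤ (k : ℕ∞) ∨ Γ.crossings G f ≤ (k : ℕ∞)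

end ConvexGraphDrawing

namespace ConvexGraphDrawing

open SimpleGraph

/-! Write k = j + 1, order the vertices by angle, and triangulate their polygon so that every chord
used is crossed by at most 2j + 1 edges. To split a chord uv (`exists_split`), take a crossing edge
xy whose inner end x is a median: at most j crossing edges have their inner end strictly on each
side of x. If xy has at most k crossings, x is the apex: an edge crossing ux or xv either crosses xy
or is one of those j. Otherwise every edge crossing xy has at most k crossings. Among the edges
within [u, v] that pass over x, an end of an outermost one other than uv then serves as apex; if
there is none, x does.

The tree decomposition follows the triangles (`hasDecomp_triangle`, `hasDecomp_Icc`). The interface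
of a chord consists of its two ends and the inner ends of the edges crossing it. In a triangle, let
α, β, γ count the edges between the three pairs of regions behind its sides. Each side is crossed by
two of these classes, so each pairwise sum is at most 2j + 1, and α + β + γ ≤ 3j + 1. Three corners
and one end per edge make at most 3j + 4 vertices. Passing from one end to the other
(`HasDecomp.exchange`) needs one spare place; all bags fit into 3j + 5 = 3k + 2. -/

/-- The disjoint union of two graphs with one edge added between the parts. -/
def joinGraph {M N : Type*} (S : SimpleGraph M) (T : SimpleGraph N) (a : M) (b : N) :
    SimpleGraph (M ⊕ N) :=
  (S ⊕g T) ⊔ edge (Sum.inl a) (Sum.inr b)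

/-! ### Gluing two trees along a new edge. -/

section joinGraph

variable {M N : Type*} {S : SimpleGraph M} {T : SimpleGraph N} {a : M} {b : N}

lemma joinGraph_adj_bridge : (joinGraph S T a b).Adj (Sum.inl a) (Sum.inr b) := by
  simp [joinGraph, edge_adj]

lemma joinGraph_adj_inl {x y : M} (h : S.Adj x y) :
    (joinGraph S T a b).Adj (Sum.inl x) (Sum.inl y) := by
  simp [joinGraph, h]

lemma joinGraph_adj_inr {x y : N} (h : T.Adj x y) :
    (joinGraph S T a b).Adj (Sum.inr x) (Sum.inr y) := by
  simp [joinGraph, h]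

lemma induce_image_inl_connected {A : Set M} (h : (S.induce A).Connected) :
    ((joinGraph S T a b).induce (Sum.inl '' A)).Connected := by
  refine h.map (H := (joinGraph S T a b).induce (Sum.inl '' A))
    ⟨fun x => ⟨Sum.inl x.1, x.1, x.2, rfl⟩, ?_⟩ ?_
  · intro x y hxy
    exact joinGraph_adj_inl hxy
  · rintro ⟨_, x, hx, rfl⟩
    exact ⟨⟨x, hx⟩, rfl⟩

lemma induce_image_inr_connected {A : Set N} (h : (T.induce A).Connected) :
    ((joinGraph S T a b).induce (Sum.inr '' A)).Connected := by
  refine h.map (H := (joinGraph S T a b).induce (Sum.inr '' A))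
    ⟨fun x => ⟨Sum.inr x.1, x.1, x.2, rfl⟩, ?_⟩ ?_
  · intro x y hxy
    exact joinGraph_adj_inr hxy
  · rintro ⟨_, x, hx, rfl⟩
    exact ⟨⟨x, hx⟩, rfl⟩

lemma joinGraph_connected (hS : S.Connected) (hT : T.Connected) :
    (joinGraph S T a b).Connected := by
  have h1 : (S.induce Set.univ).Connected := (induceUnivIso S).connected_iff.2 hS
  have h2 : (T.induce Set.univ).Connected := (induceUnivIso T).connected_iff.2 hT
  have h := connected_induce_union (induce_image_inl_connected (T := T) (a := a) (b := b) h1).1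
    (induce_image_inr_connected (S := S) (a := a) (b := b) h2).1
    (Set.mem_image_of_mem _ (Set.mem_univ a)) (Set.mem_image_of_mem _ (Set.mem_univ b))
    joinGraph_adj_bridge
  rw [Set.image_univ, Set.image_univ, Set.range_inl_union_range_inr] at h
  exact (induceUnivIso _).connected_iff.1 h

lemma joinGraph_isTree [Finite M] [Finite N] (hS : S.IsTree) (hT : T.IsTree) :
    (joinGraph S T a b).IsTree := by
  have hc : (joinGraph S T a b).Connected := joinGraph_connected hS.connected hT.connected
  -- Connectivity already gives enough edges, so only an upper bound on their number is left to
  -- prove.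
  refine isTree_iff_connected_and_card.2 ⟨hc, le_antisymm ?_ hc.card_vert_le_card_edgeSet_add_one⟩
  have h1 := (isTree_iff_connected_and_card.1 hS).2
  have h2 := (isTree_iff_connected_and_card.1 hT).2
  rw [Nat.card_coe_set_eq] at h1 h2 ⊢
  have hsub : (joinGraph S T a b).edgeSet ⊆
      (Sym2.map Sum.inl '' S.edgeSet ∪ Sym2.map Sum.inr '' T.edgeSet) ∪
        {s(Sum.inl a, Sum.inr b)} := by
    intro e
    induction e with
    | h x y =>
      rw [mem_edgeSet, joinGraph, sup_adj, adj_edge]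
      rintro (h | h)
      · left
        rcases x with x | x <;> rcases y with y | y
        · exact Or.inl ⟨s(x, y), by simpa using h, rfl⟩
        · simp at h
        · simp at h
        · exact Or.inr ⟨s(x, y), by simpa using h, rfl⟩
      · exact Or.inr h.1.symm
  have h3 := Set.ncard_le_ncard hsub (Set.toFinite _)
  have h4 := Set.ncard_union_le
    (Sym2.map (Sum.inl : M → M ⊕ N) '' S.edgeSet ∪ Sym2.map Sum.inr '' T.edgeSet)
    {s(Sum.inl a, Sum.inr b)}
  have h5 := Set.ncard_union_le
    (Sym2.map (Sum.inl : M → M ⊕ N) '' S.edgeSet) (Sym2.map Sum.inr '' T.edgeSet)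
  have h6 := Set.ncard_image_le (f := Sym2.map (Sum.inl : M → M ⊕ N)) S.edgeSet.toFinite
  have h7 := Set.ncard_image_le (f := Sym2.map (Sum.inr : N → M ⊕ N)) T.edgeSet.toFinite
  rw [Set.ncard_singleton] at h4
  rw [Nat.card_sum]
  omega

end joinGraph

/-! ### Rooted tree decompositions and how to combine them. -/

/-- There is a tree decomposition with bags of size at most `n` of the graph with vertex set `S` and
edge relation `H`, in which some bag contains `R`. -/
def HasDecomp {V : Type*} (H : V → V → Prop) (n : ℕ) (S R : Set V) : Prop :=
  ∃ (N : Type) (_ : Finite N) (T : SimpleGraph N) (bag : N → Set V) (r : N),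
    T.IsTree ∧ R ⊆ bag r ∧ (∀ i, bag i ⊆ S) ∧ (∀ i, (bag i).ncard ≤ n) ∧
    (∀ v ∈ S, (T.induce {i | v ∈ bag i}).Connected) ∧
    ∀ a b, H a b → ∃ i, a ∈ bag i ∧ b ∈ bag i

namespace HasDecomp

variable {V : Type*} {H H₁ H₂ : V → V → Prop} {n : ℕ} {S S₁ S₂ R R₁ R₂ B : Set V}

lemma mono (h : HasDecomp H₁ n S R₁) (hH : ∀ a b, H₂ a b → H₁ a b) (hR : R₂ ⊆ R₁) :
    HasDecomp H₂ n S R₂ := by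
  obtain ⟨N, hN, T, bag, r, h1, h2, h3, h4, h5, h6⟩ := h
  exact ⟨N, hN, T, bag, r, h1, hR.trans h2, h3, h4, h5, fun a b hab => h6 a b (hH a b hab)⟩

lemma single (hB : B.ncard ≤ n) : HasDecomp (fun a b => a ∈ B ∧ b ∈ B) n B B := by
  refine ⟨PUnit, inferInstance, ⊥, fun _ => B, PUnit.unit, IsTree.of_subsingleton, subset_rfl,
    fun _ => subset_rfl, fun _ => hB, fun v hv => ?_, fun a b hab => ⟨PUnit.unit, hab⟩⟩
  have : Nonempty {i : PUnit | v ∈ B} := ⟨⟨PUnit.unit, hv⟩⟩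
  have : Subsingleton {i : PUnit | v ∈ B} := inferInstance
  exact IsTree.of_subsingleton.connected

/-- Two decompositions that share only vertices of their root bags can be joined at the roots. -/
lemma join (h₁ : HasDecomp H₁ n S₁ R₁) (h₂ : HasDecomp H₂ n S₂ R₂) (hR₁ : S₁ ∩ S₂ ⊆ R₁)
    (hR₂ : S₁ ∩ S₂ ⊆ R₂) : HasDecomp (fun a b => H₁ a b ∨ H₂ a b) n (S₁ ∪ S₂) R₁ := by
  obtain ⟨M, hM, T, bag, r, h1, h2, h3, h4, h5, h6⟩ := h₁
  obtain ⟨N, hN, T', bag', r', h1', h2', h3', h4', h5', h6'⟩ := h₂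
  refine ⟨M ⊕ N, inferInstance, joinGraph T T' r r', Sum.elim bag bag', Sum.inl r,
    joinGraph_isTree h1 h1', h2, ?_, ?_, ?_, ?_⟩
  · rintro (i | i)
    · exact (h3 i).trans Set.subset_union_left
    · exact (h3' i).trans Set.subset_union_right
  · rintro (i | i)
    · exact h4 i
    · exact h4' i
  · intro v hv
    have heq : {i | v ∈ Sum.elim bag bag' i} =
        Sum.inl '' {i | v ∈ bag i} ∪ Sum.inr '' {i | v ∈ bag' i} := by
      ext (i | i) <;> simp
    rw [heq]
    by_cases hv1 : v ∈ S₁ <;> by_cases hv2 : v ∈ S₂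
    · exact connected_induce_union (induce_image_inl_connected (h5 v hv1)).1
        (induce_image_inr_connected (h5' v hv2)).1
        (Set.mem_image_of_mem _ (h2 (hR₁ ⟨hv1, hv2⟩)))
        (Set.mem_image_of_mem _ (h2' (hR₂ ⟨hv1, hv2⟩))) joinGraph_adj_bridge
    · have : {i | v ∈ bag' i} = ∅ := Set.eq_empty_of_forall_notMem fun i hi => hv2 (h3' i hi)
      rw [this, Set.image_empty, Set.union_empty]
      exact induce_image_inl_connected (h5 v hv1)
    · have : {i | v ∈ bag i} = ∅ := Set.eq_empty_of_forall_notMem fun i hi => hv1 (h3 i hi)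
      rw [this, Set.image_empty, Set.empty_union]
      exact induce_image_inr_connected (h5' v hv2)
    · exact absurd hv (by simp [hv1, hv2])
  · rintro a b (hab | hab)
    · obtain ⟨i, hi⟩ := h6 a b hab
      exact ⟨Sum.inl i, hi⟩
    · obtain ⟨i, hi⟩ := h6' a b hab
      exact ⟨Sum.inr i, hi⟩

/-- A new bag can be put on top of the root bag. -/
lemma addBag (h : HasDecomp H n S R) (hB : B.ncard ≤ n) (hR : B ∩ S ⊆ R) :
    HasDecomp (fun a b => H a b ∨ a ∈ B ∧ b ∈ B) n (B ∪ S) B :=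
  ((single hB).join h Set.inter_subset_left hR).mono (fun _ _ => Or.symm) subset_rfl

lemma treewidth_le [Finite V] {G : SimpleGraph V} (h : HasDecomp G.Adj (n + 1) Set.univ R) :
    treewidth G ≤ (n : ℕ∞) := by
  obtain ⟨N, hN, T, bag, r, h1, h2, h3, h4, h5, h6⟩ := h
  let D : TreeDecomposition G :=
    { Node := N
      finite_node := hN
      tree := T
      isTree := h1
      bag := bag
      vertex_cover := fun v => by
        obtain ⟨i⟩ := (h5 v trivial).nonempty
        exact ⟨i.1, i.2⟩
      edge_cover := h6
      subtree := fun v => h5 v trivial }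
  refine (iInf_le _ D).trans (tsub_le_iff_right.2 (iSup_le fun i => ?_))
  rw [← (Set.toFinite (D.bag i)).cast_ncard_eq]
  exact_mod_cast h4 i

end HasDecomp

/-! ### Counting edges between vertex sets. -/

section edgesBetween

variable {V : Type*} (G : SimpleGraph V)

/-- The edges of `G` with one end in `A` and the other end in `B`. -/
def edgesBetween (A B : Set V) : Set (Sym2 V) :=
  {s | ∃ a ∈ A, ∃ b ∈ B, G.Adj a b ∧ s = s(a, b)}

/-- The vertices in `A` that have a neighbour in `B`. -/
def touching (A B : Set V) : Set V :=
  {a ∈ A | ∃ b ∈ B, G.Adj a b}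

variable {G} {A B A₁ B₁ A₂ B₂ : Set V} {a b : V}

lemma mem_edgesBetween (ha : a ∈ A) (hb : b ∈ B) (h : G.Adj a b) : s(a, b) ∈ edgesBetween G A B :=
  ⟨a, ha, b, hb, h, rfl⟩

lemma mem_edgesBetween_swap (ha : a ∈ A) (hb : b ∈ B) (h : G.Adj a b) :
    s(b, a) ∈ edgesBetween G A B :=
  ⟨a, ha, b, hb, h, Sym2.eq_swap⟩

lemma edgesBetween_comm : edgesBetween G A B = edgesBetween G B A := by
  ext s
  constructor <;> rintro ⟨a, ha, b, hb, h, rfl⟩ <;>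
    exact mem_edgesBetween_swap hb ha h.symm

lemma edgesBetween_mono (hA : A₁ ⊆ A) (hB : B₁ ⊆ B) :
    edgesBetween G A₁ B₁ ⊆ edgesBetween G A B := by
  rintro s ⟨a, ha, b, hb, h, rfl⟩
  exact mem_edgesBetween (hA ha) (hB hb) h

/-- The end in `A₁` of a common edge would have to lie in `A₂` or in `B₂`. -/
lemma disjoint_edgesBetween (hA : Disjoint A₁ A₂) (h : Disjoint A₁ B₂) :
    Disjoint (edgesBetween G A₁ B₁) (edgesBetween G A₂ B₂) := by
  rw [Set.disjoint_left] at *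
  rintro s ⟨a, ha, b, hb, -, rfl⟩ ⟨c, hc, d, hd, -, hs⟩
  rcases Sym2.eq_iff.1 hs with ⟨rfl, rfl⟩ | ⟨rfl, rfl⟩
  · exact hA ha hc
  · exact h ha hd

variable [Finite V]

lemma ncard_edgesBetween_mono (hA : A₁ ⊆ A) (hB : B₁ ⊆ B) :
    (edgesBetween G A₁ B₁).ncard ≤ (edgesBetween G A B).ncard :=
  Set.ncard_le_ncard (edgesBetween_mono hA hB) (Set.toFinite _)

lemma ncard_edgesBetween_le_add
    (h : ∀ a ∈ A, ∀ b ∈ B, G.Adj a b →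
      s(a, b) ∈ edgesBetween G A₁ B₁ ∨ s(a, b) ∈ edgesBetween G A₂ B₂) :
    (edgesBetween G A B).ncard ≤ (edgesBetween G A₁ B₁).ncard + (edgesBetween G A₂ B₂).ncard := by
  refine (Set.ncard_le_ncard ?_ (Set.toFinite _)).trans (Set.ncard_union_le _ _)
  rintro s ⟨a, ha, b, hb, hab, rfl⟩
  exact h a ha b hb hab

lemma ncard_edgesBetween_add_le (h₁ : edgesBetween G A₁ B₁ ⊆ edgesBetween G A B)
    (h₂ : edgesBetween G A₂ B₂ ⊆ edgesBetween G A B)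
    (h : Disjoint (edgesBetween G A₁ B₁) (edgesBetween G A₂ B₂)) :
    (edgesBetween G A₁ B₁).ncard + (edgesBetween G A₂ B₂).ncard ≤ (edgesBetween G A B).ncard := by
  rw [← Set.ncard_union_eq h (Set.toFinite _) (Set.toFinite _)]
  exact Set.ncard_le_ncard (Set.union_subset h₁ h₂) (Set.toFinite _)

lemma ncard_edgesBetween_eq_zero (h : ∀ a ∈ A, ∀ b ∈ B, ¬ G.Adj a b) :
    (edgesBetween G A B).ncard = 0 := by
  rw [Set.ncard_eq_zero (Set.toFinite _)]
  refine Set.eq_empty_of_forall_notMem ?_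
  rintro s ⟨a, ha, b, hb, hab, rfl⟩
  exact h a ha b hb hab

/-- Choosing one edge per touching vertex is injective, because an edge has only one end in `A`. -/
lemma ncard_touching_le (h : Disjoint A B) :
    (touching G A B).ncard ≤ (edgesBetween G A B).ncard := by
  have hc : ∀ a ∈ touching G A B, ∃ b ∈ B, G.Adj a b := fun a ha => ha.2
  choose! f hf1 hf2 using hc
  refine Set.ncard_le_ncard_of_injOn (fun a => s(a, f a))
    (fun a ha => mem_edgesBetween ha.1 (hf1 a ha) (hf2 a ha)) ?_ (Set.toFinite _)
  intro a ha b hb hab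
  rcases Sym2.eq_iff.1 hab with h' | h'
  · exact h'.1
  · exact absurd (h'.1 ▸ hf1 b hb : a ∈ B) (Set.disjoint_left.1 h ha.1)

end edgesBetween

/-! ### Splitting a chord into two chords with few crossings. -/

section split

variable {V : Type*} [LinearOrder V] (G : SimpleGraph V)

/-- The edges of `G` that cross the chord between `u` and `v`, where `u < v`. -/
def chordCrossings (u v : V) : Set (Sym2 V) :=
  edgesBetween G (Set.Ioo u v) (Set.Icc u v)ᶜ

/-- Of any two edges with interleaving ends, one has at most `k` crossings. -/
def InterleaveBound (k : ℕ) : Prop :=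
  ∀ a b c d, a < c → c < b → b < d → G.Adj a b → G.Adj c d →
    (chordCrossings G a b).ncard ≤ k ∨ (chordCrossings G c d).ncard ≤ k

variable {G} [Finite V] {u v x w z : V} {j k : ℕ}

lemma ncard_edgesBetween_le_chordCrossings {A B : Set V} (hA : A ⊆ Set.Ioo u v)
    (hB : B ⊆ (Set.Icc u v)ᶜ) :
    (edgesBetween G A B).ncard ≤ (chordCrossings G u v).ncard :=
  ncard_edgesBetween_mono hA hB

/-- The apex is `w` if `z = v`, and `z` otherwise. An edge crossing a new side either crosses `wz`
(at most `k` of these) or leaves `[u, v]` from one side of `x` (at most `j`): any other would pass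
over `wz`, against `hmax`. -/
lemma exists_split_of_outermost (huw : u ≤ w) (hwx : w < x) (hxz : x < z) (hzv : z ≤ v)
    (hne : u < w ∨ z < v) (hk : (chordCrossings G w z).ncard ≤ k)
    (hmax : ∀ a b, u ≤ a → a ≤ w → z ≤ b → b ≤ v → u < a ∨ b < v → G.Adj a b → w ≤ a ∧ b ≤ z)
    (hl : (edgesBetween G (Set.Ioo u x) (Set.Icc u v)ᶜ).ncard ≤ j)
    (hr : (edgesBetween G (Set.Ioo x v) (Set.Icc u v)ᶜ).ncard ≤ j) :
    ∃ t, u < t ∧ t < v ∧ (chordCrossings G u t).ncard ≤ k + j ∧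
      (chordCrossings G t v).ncard ≤ k + j := by
  by_cases hz : z = v
  · have hw : u < w := hne.resolve_right hz.not_lt
    refine ⟨w, hw, hwx.trans (hxz.trans_le hzv), ?_, ?_⟩
    · refine (ncard_edgesBetween_le_add ?_).trans (add_le_add hk hl)
      intro a ha b hb hab
      by_cases hb1 : b ∈ Set.Ioo w z
      · exact Or.inl (mem_edgesBetween_swap hb1 (by simp_all) hab.symm)
      · refine Or.inr (mem_edgesBetween ⟨ha.1, ha.2.trans hwx⟩ ?_ hab)
        have := hmax a b ha.1.le ha.2.le
        simp only [Set.mem_Ioo, Set.mem_Icc, Set.mem_compl_iff] at *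
        grind
    · refine (ncard_edgesBetween_le_add (A₂ := Set.Ioo x v) (B₂ := (Set.Icc u v)ᶜ) ?_).trans
        (add_le_add hk hr)
      intro a ha b hb hab
      exact Or.inl (mem_edgesBetween (hz ▸ ha) (hz ▸ hb) hab)
  · have hz : z < v := lt_of_le_of_ne hzv hz
    refine ⟨z, huw.trans_lt (hwx.trans hxz), hz, ?_, ?_⟩
    · refine (ncard_edgesBetween_le_add ?_).trans (add_le_add hk hl)
      intro a ha b hb hab
      by_cases ha1 : w < a
      · refine Or.inl (mem_edgesBetween ⟨ha1, ha.2⟩ ?_ hab)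
        simp only [Set.mem_Icc, Set.mem_compl_iff] at *
        grind
      · refine Or.inr (mem_edgesBetween ⟨ha.1, (not_lt.1 ha1).trans_lt hwx⟩ ?_ hab)
        have := hmax a b ha.1.le (not_lt.1 ha1)
        simp only [Set.mem_Ioo, Set.mem_Icc, Set.mem_compl_iff] at *
        grind
    · refine (ncard_edgesBetween_le_add ?_).trans (add_le_add hk hr)
      intro a ha b hb hab
      by_cases hb1 : b ∈ Set.Ioo w z
      · refine Or.inl (mem_edgesBetween_swap hb1 ?_ hab.symm)
        simp only [Set.mem_Ioo, Set.mem_Icc, Set.mem_compl_iff] at *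
        grind
      · refine Or.inr (mem_edgesBetween ⟨hxz.trans ha.1, ha.2⟩ ?_ hab)
        have := hmax b a
        have := hab.symm
        simp only [Set.mem_Ioo, Set.mem_Icc, Set.mem_compl_iff] at *
        grind

/-- Either `x` itself is the apex, or all edges passing over `x` have few crossings and an outermost
one supplies the apex. The edge `uv` is excluded, since its ends give no new vertex. -/
lemma exists_split_of_pivot (hux : u < x) (hxv : x < v)
    (hl : (edgesBetween G (Set.Ioo u x) (Set.Icc u v)ᶜ).ncard ≤ j)
    (hr : (edgesBetween G (Set.Ioo x v) (Set.Icc u v)ᶜ).ncard ≤ j)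
    (h : (edgesBetween G (Set.Ioo u x) (Set.Ioc x v)).ncard ≤ k ∧
        (edgesBetween G (Set.Ioo x v) (Set.Ico u x)).ncard ≤ k ∨
      ∀ w z, u ≤ w → w < x → x < z → z ≤ v → u < w ∨ z < v → G.Adj w z →
        (chordCrossings G w z).ncard ≤ k) :
    ∃ t, u < t ∧ t < v ∧ (chordCrossings G u t).ncard ≤ k + j ∧
      (chordCrossings G t v).ncard ≤ k + j := by
  have key : ((edgesBetween G (Set.Ioo u x) (Set.Ioc x v)).ncard ≤ k ∧
        (edgesBetween G (Set.Ioo x v) (Set.Ico u x)).ncard ≤ k) →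
      ∃ t, u < t ∧ t < v ∧ (chordCrossings G u t).ncard ≤ k + j ∧
      (chordCrossings G t v).ncard ≤ k + j := by
    rintro ⟨h1, h2⟩
    refine ⟨x, hux, hxv, (ncard_edgesBetween_le_add ?_).trans (add_le_add h1 hl),
      (ncard_edgesBetween_le_add ?_).trans (add_le_add h2 hr)⟩
    · intro a ha b hb hab
      by_cases hb1 : b ∈ Set.Ioc x v
      · exact Or.inl (mem_edgesBetween ha hb1 hab)
      · refine Or.inr (mem_edgesBetween ha ?_ hab)
        simp only [Set.mem_Ioc, Set.mem_Icc, Set.mem_compl_iff] at *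
        grind
    · intro a ha b hb hab
      by_cases hb1 : b ∈ Set.Ico u x
      · exact Or.inl (mem_edgesBetween ha hb1 hab)
      · refine Or.inr (mem_edgesBetween ha ?_ hab)
        simp only [Set.mem_Ico, Set.mem_Icc, Set.mem_compl_iff] at *
        grind
  rcases h with h | h
  · exact key h
  -- Reversing the order of the left end turns the product order into inclusion of intervals, so
  -- maximal pairs are outermost edges.
  let F : Set (Vᵒᵈ × V) := {p | u ≤ p.1.ofDual ∧ p.1.ofDual < x ∧ x < p.2 ∧ p.2 ≤ v ∧
    (u < p.1.ofDual ∨ p.2 < v) ∧ G.Adj p.1.ofDual p.2}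
  have : Finite Vᵒᵈ := ‹Finite V›
  rcases F.eq_empty_or_nonempty with hF | hF
  · have hF' : ∀ a b, u ≤ a → a < x → x < b → b ≤ v → u < a ∨ b < v → ¬ G.Adj a b := by
      intro a b h1 h2 h3 h4 h5 h6
      have : (OrderDual.toDual a, b) ∈ F := ⟨h1, h2, h3, h4, h5, h6⟩
      simp [hF] at this
    refine key ⟨?_, ?_⟩
    · rw [ncard_edgesBetween_eq_zero]
      · exact Nat.zero_le _
      · intro a ha b hb
        exact hF' a b ha.1.le ha.2 hb.1 hb.2 (Or.inl ha.1)
    · rw [ncard_edgesBetween_eq_zero]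
      · exact Nat.zero_le _
      · intro b hb a ha hab
        exact hF' a b ha.1 ha.2 hb.1 hb.2.le (Or.inr hb.2) hab.symm
  · obtain ⟨⟨w, z⟩, hm⟩ := (Set.toFinite F).exists_maximal hF
    obtain ⟨h1, h2, h3, h4, h5, h6⟩ := hm.prop
    refine exists_split_of_outermost h1 h2 h3 h4 h5 (h _ _ h1 h2 h3 h4 h5 h6) ?_ hl hr
    intro a b ha1 ha2 hb1 hb2 hne hab
    have hp : (OrderDual.toDual a, b) ∈ F := ⟨ha1, ha2.trans_lt h2, h3.trans_le hb1, hb2, hne, hab⟩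
    exact hm.le_of_ge hp ⟨ha2, hb1⟩

/-- A median of the inner ends of the edges that cross a chord. -/
lemma exists_median (hc : (chordCrossings G u v).ncard ≤ 2 * j + 1)
    (hne : (touching G (Set.Ioo u v) (Set.Icc u v)ᶜ).Nonempty) :
    ∃ x ∈ touching G (Set.Ioo u v) (Set.Icc u v)ᶜ,
      (edgesBetween G (Set.Ioo u x) (Set.Icc u v)ᶜ).ncard ≤ j ∧
      (edgesBetween G (Set.Ioo x v) (Set.Icc u v)ᶜ).ncard ≤ j := by
  set T := touching G (Set.Ioo u v) (Set.Icc u v)ᶜ with hT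
  obtain ⟨m, hm⟩ := (Set.toFinite T).exists_maximal hne
  obtain ⟨x, hx⟩ := (Set.toFinite
    {x ∈ T | (edgesBetween G (Set.Ioo x v) (Set.Icc u v)ᶜ).ncard ≤ j}).exists_minimal
    ⟨m, hm.prop, by
      rw [ncard_edgesBetween_eq_zero]
      · exact Nat.zero_le _
      · intro a ha b hb hab
        have : a ∈ T := ⟨⟨hm.prop.1.1.trans ha.1, ha.2⟩, b, hb, hab⟩
        exact absurd (hm.le_of_ge this ha.1.le) (not_le.2 ha.1)⟩
  refine ⟨x, hx.prop.1, ?_, hx.prop.2⟩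
  rcases (T ∩ Set.Iio x).eq_empty_or_nonempty with hE | hE
  · rw [ncard_edgesBetween_eq_zero]
    · exact Nat.zero_le _
    · intro a ha b hb hab
      have : a ∈ T ∩ Set.Iio x := ⟨⟨⟨ha.1, ha.2.trans hx.prop.1.1.2⟩, b, hb, hab⟩, ha.2⟩
      simp [hE] at this
  -- `y` precedes `x` among the inner ends. By minimality of `x`, more than `j` edges have inner end
  -- beyond `y`; those with inner end before `x` are different edges, so at most `j` of them remain.
  · obtain ⟨y, hy⟩ := (Set.toFinite (T ∩ Set.Iio x)).exists_maximal hE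
    have hyx : y < x := hy.prop.2
    have h1 : j < (edgesBetween G (Set.Ioo y v) (Set.Icc u v)ᶜ).ncard := by
      by_contra hcon
      exact absurd (hx.le_of_le ⟨hy.prop.1, not_lt.1 hcon⟩ hyx.le) (not_le.2 hyx)
    have h2 : (edgesBetween G (Set.Ioo u x) (Set.Icc u v)ᶜ).ncard +
        (edgesBetween G (Set.Ioo y v) (Set.Icc u v)ᶜ).ncard ≤ (chordCrossings G u v).ncard := by
      refine ncard_edgesBetween_add_le
        (edgesBetween_mono (Set.Ioo_subset_Ioo_right hx.prop.1.1.2.le) subset_rfl)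
        (edgesBetween_mono (Set.Ioo_subset_Ioo_left hy.prop.1.1.1.le) subset_rfl) ?_
      rw [Set.disjoint_left]
      rintro s ⟨a, ha, b, hb, hab, rfl⟩ ⟨c, hc, d, hd, hcd, hs⟩
      rcases Sym2.eq_iff.1 hs with ⟨rfl, rfl⟩ | ⟨rfl, rfl⟩
      · have : a ∈ T ∩ Set.Iio x := ⟨⟨⟨ha.1, ha.2.trans hx.prop.1.1.2⟩, b, hb, hab⟩, ha.2⟩
        exact absurd (hy.le_of_ge this hc.1.le) (not_le.2 hc.1)
      · exact hd ⟨ha.1.le, (ha.2.trans hx.prop.1.1.2).le⟩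
    omega

/-- If a chord with a vertex behind it has few crossings, then some vertex behind it spans a triangle
with it whose other two sides have few crossings. -/
lemma exists_split (hG : InterleaveBound G (j + 1)) (hc : (chordCrossings G u v).ncard ≤ 2 * j + 1)
    (hne : (Set.Ioo u v).Nonempty) :
    ∃ t, u < t ∧ t < v ∧ (chordCrossings G u t).ncard ≤ 2 * j + 1 ∧
      (chordCrossings G t v).ncard ≤ 2 * j + 1 := by
  have hj : 2 * j + 1 = j + 1 + j := by ring
  rw [hj]
  rcases (touching G (Set.Ioo u v) (Set.Icc u v)ᶜ).eq_empty_or_nonempty with hT | hT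
  · have hout : ∀ A ⊆ Set.Ioo u v, (edgesBetween G A (Set.Icc u v)ᶜ).ncard ≤ j := by
      intro A hA
      rw [ncard_edgesBetween_eq_zero]
      · exact Nat.zero_le _
      · intro a ha b hb hab
        have : a ∈ touching G (Set.Ioo u v) (Set.Icc u v)ᶜ := ⟨hA ha, b, hb, hab⟩
        simp [hT] at this
    rcases (touching G (Set.Ioo u v) {u}).eq_empty_or_nonempty with hN | hN
    · obtain ⟨x, hx⟩ := (Set.toFinite (Set.Ioo u v)).exists_minimal hne
      have hmin : ∀ a, u < a → a < x → False := fun a h1 h2 =>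
        absurd (hx.le_of_le ⟨h1, h2.trans hx.prop.2⟩ h2.le) (not_le.2 h2)
      refine exists_split_of_pivot hx.prop.1 hx.prop.2
        (hout _ (Set.Ioo_subset_Ioo_right hx.prop.2.le))
        (hout _ (Set.Ioo_subset_Ioo_left hx.prop.1.le)) (Or.inl ⟨?_, ?_⟩)
      · rw [ncard_edgesBetween_eq_zero]
        · exact Nat.zero_le _
        · intro a ha
          exact (hmin a ha.1 ha.2).elim
      · rw [ncard_edgesBetween_eq_zero]
        · exact Nat.zero_le _
        · intro b hb a ha hab
          rcases ha.1.eq_or_lt with rfl | h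
          · have : b ∈ touching G (Set.Ioo u v) {u} := ⟨⟨hx.prop.1.trans hb.1, hb.2⟩, u, rfl, hab⟩
            simp [hN] at this
          · exact hmin a h ha.2
    · obtain ⟨x, hx⟩ := (Set.toFinite (touching G (Set.Ioo u v) {u})).exists_maximal hN
      obtain ⟨⟨hux, hxv⟩, _, rfl, hadj⟩ := hx.prop
      rename_i u
      have hmax : ∀ b, x < b → b < v → ¬ G.Adj u b := fun b h1 h2 h3 =>
        absurd (hx.le_of_ge ⟨⟨hux.trans h1, h2⟩, u, rfl, h3.symm⟩ h1.le) (not_le.2 h1)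
      refine exists_split_of_pivot hux hxv (hout _ (Set.Ioo_subset_Ioo_right hxv.le))
        (hout _ (Set.Ioo_subset_Ioo_left hux.le)) ?_
      by_cases hlight : (chordCrossings G u x).ncard ≤ j + 1
      · refine Or.inl ⟨(ncard_edgesBetween_le_chordCrossings subset_rfl ?_).trans hlight, ?_⟩
        · intro b hb hb'
          exact absurd hb'.2 (not_le.2 hb.1)
        · refine le_trans (Set.ncard_le_ncard ?_ (Set.toFinite _)) hlight
          rintro s ⟨b, hb, a, ha, hab, rfl⟩
          refine mem_edgesBetween_swap ⟨lt_of_le_of_ne ha.1 ?_, ha.2⟩ ?_ hab.symm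
          · rintro rfl
            exact hmax b hb.1 hb.2 hab.symm
          · exact fun h => absurd h.2 (not_le.2 hb.1)
      · refine Or.inr fun w z h1 h2 h3 h4 h5 h6 => ?_
        -- An edge from `u` would share an end with `ux` instead of crossing it; the choice of `x`
        -- rules it out.
        have hw : u < w := by
          by_contra hcon
          obtain rfl := le_antisymm h1 (not_lt.1 hcon)
          exact hmax z h3 (h5.resolve_left hcon) h6
        exact (hG u x w z hw h2 h3 hadj.symm h6).resolve_left hlight
  · obtain ⟨x, ⟨⟨hux, hxv⟩, y, hy, hadj⟩, hl, hr⟩ := exists_median hc hT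
    refine exists_split_of_pivot hux hxv hl hr ?_
    have hy' : y < u ∨ v < y := by
      by_contra hcon
      push Not at hcon
      exact hy hcon
    rcases hy' with hy' | hy'
    · by_cases hlight : (chordCrossings G y x).ncard ≤ j + 1
      · refine Or.inl ⟨le_trans (ncard_edgesBetween_le_chordCrossings ?_ ?_) hlight, ?_⟩
        · exact Set.Ioo_subset_Ioo_left hy'.le
        · exact fun b hb hb' => absurd hb'.2 (not_le.2 hb.1)
        · rw [edgesBetween_comm]
          refine le_trans (ncard_edgesBetween_le_chordCrossings ?_ ?_) hlight
          · exact fun a ha => ⟨hy'.trans_le ha.1, ha.2⟩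
          · exact fun b hb hb' => absurd hb'.2 (not_le.2 hb.1)
      -- As `y` lies strictly outside `[u, v]`, the heavy edge `xy` also interleaves with edges that
      -- end at `u` or `v`.
      · refine Or.inr fun w z h1 h2 h3 _ _ h6 => ?_
        exact (hG y x w z (hy'.trans_le h1) h2 h3 hadj.symm h6).resolve_left hlight
    · by_cases hlight : (chordCrossings G x y).ncard ≤ j + 1
      · refine Or.inl ⟨?_, le_trans (ncard_edgesBetween_le_chordCrossings ?_ ?_) hlight⟩
        · rw [edgesBetween_comm]
          refine le_trans (ncard_edgesBetween_le_chordCrossings ?_ ?_) hlight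
          · exact fun a ha => ⟨ha.1, ha.2.trans_lt hy'⟩
          · exact fun b hb hb' => absurd hb'.1 (not_le.2 hb.2)
        · exact Set.Ioo_subset_Ioo_right hy'.le
        · exact fun b hb hb' => absurd hb'.1 (not_le.2 hb.2)
      · refine Or.inr fun w z _ h2 h3 h4 _ h6 => ?_
        exact (hG w z x y h2 h3 (h4.trans_lt hy') h6 hadj).resolve_right hlight

end split

/-! ### Moving a bag across a set of edges. -/

section exchange

variable {V : Type*} {G : SimpleGraph V} {H : V → V → Prop} {n : ℕ} {A B C S R A' B' : Set V}

lemma touching_subset : touching G A B ⊆ A := fun _ h => h.1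

lemma touching_mono (hA : A ⊆ A') (hB : B ⊆ B') : touching G A B ⊆ touching G A' B' :=
  fun _ h => ⟨hA h.1, h.2.imp fun _ hb => ⟨hB hb.1, hb.2⟩⟩

lemma HasDecomp.subset (h : HasDecomp H n S R) : R ⊆ S := by
  obtain ⟨N, hN, T, bag, r, h1, h2, h3, h4, h5, h6⟩ := h
  exact h2.trans (h3 r)

/-- The ends in `B` of the edges between `A` and `B` can be exchanged, one vertex at a time, for the
ends in `A`. -/
lemma HasDecomp.exchange [Finite V] (h : HasDecomp H n S (C ∪ touching G B A))
    (hAB : Disjoint A B) (hAS : Disjoint A S)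
    (hn : C.ncard + (edgesBetween G A B).ncard + 1 ≤ n) :
    HasDecomp (fun x y => H x y ∨ (x ∈ A ∧ y ∈ B ∧ G.Adj x y) ∨ (y ∈ A ∧ x ∈ B ∧ G.Adj x y)) n
      (S ∪ touching G A B) (C ∪ touching G A B) := by
  -- `D` holds the vertices of `A` already brought in; the bag keeps only those vertices of `B` that
  -- still have a neighbour in `A \ D`.
  have key : ∀ D : Set V, D ⊆ touching G A B →
      HasDecomp (fun x y => H x y ∨ (x ∈ D ∧ y ∈ B ∧ G.Adj x y) ∨ (y ∈ D ∧ x ∈ B ∧ G.Adj x y)) n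
        (S ∪ D) (C ∪ D ∪ touching G B (A \ D)) := by
    intro D hD
    induction D, Set.toFinite D using Set.Finite.induction_on with
    | empty => simpa using h
    | @insert a D ha _ ih =>
      have ih := ih ((Set.subset_insert a D).trans hD)
      have haT : a ∈ touching G A B := hD (Set.mem_insert a D)
      have hDT : D ⊆ touching G A B := (Set.subset_insert a D).trans hD
      have hDA : D ⊆ A := hDT.trans touching_subset
      have hsub := ih.subset
      -- Charge `D` to its edges into `B` and the remaining part of `B` to the edges from `A \ D`.
      -- These are disjoint sets of edges; the new vertex `a` costs the extra 1.
      have hcard : (C ∪ insert a D ∪ touching G B (A \ D)).ncard ≤ n := by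
        have h1 := Set.ncard_union_le (C ∪ insert a D) (touching G B (A \ D))
        have h2 := Set.ncard_union_le C (insert a D)
        have h3 := Set.ncard_insert_le a D
        have h4 : (touching G B (A \ D)).ncard ≤ _ :=
          ncard_touching_le (hAB.symm.mono_right Set.sdiff_subset)
        have h5 : D.ncard ≤ _ :=
          (Set.ncard_le_ncard (fun x hx => ⟨hx, (hDT hx).2⟩ : D ⊆ touching G D B)
            (Set.toFinite _)).trans (ncard_touching_le (hAB.mono_left hDA))
        rw [edgesBetween_comm] at h4
        have h6 := ncard_edgesBetween_add_le (edgesBetween_mono (G := G) hDA (subset_refl B))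
          (edgesBetween_mono (G := G) (Set.sdiff_subset (s := A) (t := D)) (subset_refl B))
          (disjoint_edgesBetween disjoint_sdiff_self_right (hAB.mono_left hDA))
        omega
      have hstep := ih.addBag hcard (by
        rintro x ⟨(hx | rfl | hx) | hx, hx'⟩
        · exact Or.inl (Or.inl hx)
        · rcases hx' with hx' | hx'
          · exact absurd hx' (Set.disjoint_left.1 hAS haT.1)
          · exact absurd hx' ha
        · exact Or.inl (Or.inr hx)
        · exact Or.inr hx)
      have hS : C ∪ insert a D ∪ touching G B (A \ D) ∪ (S ∪ D) = S ∪ insert a D := by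
        ext x
        have := @hsub x
        simp only [Set.mem_union, Set.mem_insert_iff] at *
        tauto
      rw [hS] at hstep
      -- All neighbours of `a` in `B` are still present when `a` enters, so one bag covers all its
      -- edges into `B`.
      have haD : ∀ y ∈ B, G.Adj a y → y ∈ touching G B (A \ D) :=
        fun y hy hay => ⟨hy, a, ⟨haT.1, ha⟩, hay.symm⟩
      refine hstep.mono ?_ (Set.union_subset_union_right _
        (touching_mono subset_rfl (Set.sdiff_subset_sdiff_right (Set.subset_insert a D))))
      rintro x y (hxy | ⟨rfl | hx, hy, hxy⟩ | ⟨rfl | hx, hy, hxy⟩)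
      · exact Or.inl (Or.inl hxy)
      · exact Or.inr ⟨Or.inl (Or.inr (Or.inl rfl)), Or.inr (haD y hy hxy)⟩
      · exact Or.inl (Or.inr (Or.inl ⟨hx, hy, hxy⟩))
      · exact Or.inr ⟨Or.inr (haD x hy hxy.symm), Or.inl (Or.inr (Or.inl rfl))⟩
      · exact Or.inl (Or.inr (Or.inr ⟨hx, hy, hxy⟩))
  refine (key _ subset_rfl).mono ?_ Set.subset_union_left
  rintro x y (hxy | ⟨hx, hy, hxy⟩ | ⟨hx, hy, hxy⟩)
  · exact Or.inl hxy
  · exact Or.inr (Or.inl ⟨⟨hx, y, hy, hxy⟩, hy, hxy⟩)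
  · exact Or.inr (Or.inr ⟨⟨hx, x, hy, hxy.symm⟩, hy, hxy⟩)

end exchange

/-! ### The tree decomposition along the triangulation. -/

section triangulation

lemma ncard_triple_le {V : Type*} (a b c : V) : ({a, b, c} : Set V).ncard ≤ 3 := by
  have h1 := Set.ncard_insert_le a {b, c}
  have h2 := Set.ncard_insert_le b {c}
  rw [Set.ncard_singleton] at h2
  omega

lemma disjoint_Ioo_compl_Icc {V : Type*} [Preorder V] (u v : V) :
    Disjoint (Set.Ioo u v) (Set.Icc u v)ᶜ :=
  Set.disjoint_compl_right_iff_subset.2 Set.Ioo_subset_Icc_self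

variable {V : Type*} [LinearOrder V] [Finite V] {G : SimpleGraph V} {j : ℕ}

/-- A central bag takes the corners, the ends in `A` of the edges from `A` to `O` and to `B`, and
the ends in `B` of those from `B` to `O`. The `w v` side holds the `A`-`B` edges by their ends in
`B`, so it passes through an exchange before the join. -/
lemma hasDecomp_triangle {u w v : V} (huw : u < w) (hwv : w < v)
    (hcv : (chordCrossings G u v).ncard ≤ 2 * j + 1)
    (hcu : (chordCrossings G u w).ncard ≤ 2 * j + 1)
    (hcw : (chordCrossings G w v).ncard ≤ 2 * j + 1)
    (h₁ : HasDecomp (fun a b => a ∈ Set.Icc u w ∧ b ∈ Set.Icc u w ∧ G.Adj a b) (3 * j + 5)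
      (Set.Icc u w) ({u, w} ∪ touching G (Set.Ioo u w) (Set.Icc u w)ᶜ))
    (h₂ : HasDecomp (fun a b => a ∈ Set.Icc w v ∧ b ∈ Set.Icc w v ∧ G.Adj a b) (3 * j + 5)
      (Set.Icc w v) ({w, v} ∪ touching G (Set.Ioo w v) (Set.Icc w v)ᶜ)) :
    HasDecomp (fun a b => a ∈ Set.Icc u v ∧ b ∈ Set.Icc u v ∧ G.Adj a b) (3 * j + 5)
      (Set.Icc u v) ({u, v} ∪ touching G (Set.Ioo u v) (Set.Icc u v)ᶜ) := by
  set O := (Set.Icc u v)ᶜ with hO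
  set A := Set.Ioo u w with hA
  set B := Set.Ioo w v with hB
  have hAO : A ⊆ Set.Ioo u v := Set.Ioo_subset_Ioo_right hwv.le
  have hBO : B ⊆ Set.Ioo u v := Set.Ioo_subset_Ioo_left huw.le
  have hdAO : Disjoint A O := (disjoint_Ioo_compl_Icc u v).mono_left hAO
  have hdBO : Disjoint B O := (disjoint_Ioo_compl_Icc u v).mono_left hBO
  have hdAB : Disjoint A B := Set.disjoint_left.2 fun x hx hx' => lt_asymm hx.2 hx'.1
  have hO1 : O ⊆ (Set.Icc u w)ᶜ := Set.compl_subset_compl.2 (Set.Icc_subset_Icc_right hwv.le)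
  have hO2 : O ⊆ (Set.Icc w v)ᶜ := Set.compl_subset_compl.2 (Set.Icc_subset_Icc_left huw.le)
  have hB1 : B ⊆ (Set.Icc u w)ᶜ := fun x hx hx' => absurd hx.1 (not_lt.2 hx'.2)
  have hA2 : A ⊆ (Set.Icc w v)ᶜ := fun x hx hx' => absurd hx.2 (not_lt.2 hx'.1)
  -- the edges that cross two sides of the triangle
  have e1 := (ncard_edgesBetween_add_le (edgesBetween_mono (G := G) hAO (subset_refl O))
    (edgesBetween_mono (G := G) hBO (subset_refl O)) (disjoint_edgesBetween hdAB hdAO)).trans hcv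
  have e2 := (ncard_edgesBetween_add_le (edgesBetween_mono (G := G) (subset_refl A) hO1)
    (edgesBetween_mono (G := G) (subset_refl A) hB1) (by
      rw [edgesBetween_comm, edgesBetween_comm (A := A)]
      exact disjoint_edgesBetween hdBO.symm hdAO.symm)).trans hcu
  have e3 := (ncard_edgesBetween_add_le (edgesBetween_mono (G := G) (subset_refl B) hO2)
    (edgesBetween_mono (G := G) (subset_refl B) hA2) (by
      rw [edgesBetween_comm, edgesBetween_comm (A := B)]
      exact disjoint_edgesBetween hdAO.symm hdBO.symm)).trans hcw
  rw [edgesBetween_comm (A := B) (B := A)] at e3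
  have t1 := ncard_touching_le (G := G) hdAO
  have t2 := ncard_touching_le (G := G) hdBO
  have t3 := ncard_touching_le (G := G) hdAB
  have t4 : (touching G A (Set.Icc u w)ᶜ).ncard ≤ 2 * j + 1 :=
    (ncard_touching_le (G := G) (disjoint_Ioo_compl_Icc u w)).trans hcu
  have t5 : (touching G B (Set.Icc w v)ᶜ).ncard ≤ 2 * j + 1 :=
    (ncard_touching_le (G := G) (disjoint_Ioo_compl_Icc w v)).trans hcw
  have t6 := ncard_triple_le u w v
  have s1 : touching G A O ⊆ touching G A (Set.Icc u w)ᶜ := touching_mono subset_rfl hO1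
  have s2 : touching G A B ⊆ touching G A (Set.Icc u w)ᶜ := touching_mono subset_rfl hB1
  have s3 : touching G B O ⊆ touching G B (Set.Icc w v)ᶜ := touching_mono subset_rfl hO2
  have s4 : touching G B A ⊆ touching G B (Set.Icc w v)ᶜ := touching_mono subset_rfl hA2
  -- Adding the third corner `v` lets this bag cover the edges from `A` to `v`; the analogous bag on
  -- the other side covers those from `u` to `B`.
  have k1 := h₁.addBag (B := {u, w, v} ∪ touching G A (Set.Icc u w)ᶜ)
    (by
      have := Set.ncard_union_le {u, w, v} (touching G A (Set.Icc u w)ᶜ)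
      omega)
    (by
      rintro x ⟨(rfl | rfl | rfl) | hx, hx'⟩
      · simp
      · simp
      · exact absurd hx'.2 (not_le.2 hwv)
      · exact Or.inr hx)
  have k2 := ((h₂.addBag (B := {u, w, v} ∪ touching G B (Set.Icc w v)ᶜ)
    (by
      have := Set.ncard_union_le {u, w, v} (touching G B (Set.Icc w v)ᶜ)
      omega)
    (by
      rintro x ⟨(rfl | rfl | rfl) | hx, hx'⟩
      · exact absurd hx'.1 (not_le.2 huw)
      · simp
      · simp
      · exact Or.inr hx)).mono (R₂ := ({u, w, v} ∪ touching G B O) ∪ touching G B A)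
      (fun _ _ => id) (by
        rw [Set.union_assoc]
        exact Set.union_subset_union_right _ (Set.union_subset s3 s4))).exchange hdAB
    (by
      rw [Set.disjoint_left]
      rintro x hx (((rfl | rfl | rfl) | hx') | hx')
      · exact lt_irrefl _ hx.1
      · exact lt_irrefl _ hx.2
      · exact lt_asymm hwv hx.2
      · exact Set.disjoint_left.1 hdAB hx hx'.1
      · exact absurd hx.2 (not_lt.2 hx'.1))
    (by
      have := Set.ncard_union_le {u, w, v} (touching G B O)
      omega)
  -- Adding `e1`, `e2`, `e3` and halving bounds the three edge classes by 3j + 1 in total, hence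
  -- this bag by 3j + 4.
  have k3 := k1.addBag (B := ({u, w, v} ∪ touching G B O) ∪ touching G A B ∪ touching G A O)
    (by
      have q1 := Set.ncard_union_le ({u, w, v} ∪ touching G B O ∪ touching G A B) (touching G A O)
      have q2 := Set.ncard_union_le ({u, w, v} ∪ touching G B O) (touching G A B)
      have q3 := Set.ncard_union_le {u, w, v} (touching G B O)
      omega)
    (by
      rintro x ⟨((hx | hx) | hx) | hx, hx'⟩
      · exact Or.inl hx
      · rcases hx' with hx' | hx'
        · exact hx'
        · exact absurd hx.1.1 (not_lt.2 hx'.2)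
      · exact Or.inr (s2 hx)
      · exact Or.inr (s1 hx))
  have hTA : ∀ X, touching G A X ⊆ A := fun _ => touching_subset
  have hTB : ∀ X, touching G B X ⊆ B := fun _ => touching_subset
  have hinter : ∀ x, (x ∈ {u, w, v} ∪ touching G A (Set.Icc u w)ᶜ ∪ Set.Icc u w) →
      (x ∈ {u, w, v} ∪ touching G B (Set.Icc w v)ᶜ ∪ Set.Icc w v ∪ touching G A B) →
      x ∈ ({u, w, v} ∪ touching G B O) ∪ touching G A B := by
    rintro x hx (((hx' | hx') | hx') | hx')
    · exact Or.inl (Or.inl hx')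
    · have h3 := hx'.1.1
      rcases hx with (hx | hx) | hx
      · exact Or.inl (Or.inl hx)
      · exact absurd hx.1.2 (lt_asymm h3)
      · exact absurd h3 (not_lt.2 hx.2)
    · rcases hx with (hx | hx) | hx
      · exact Or.inl (Or.inl hx)
      · exact absurd hx.1.2 (not_lt.2 hx'.1)
      · exact Or.inl (Or.inl (Or.inr (Or.inl (le_antisymm hx.2 hx'.1))))
    · exact Or.inr hx'
  have k4 := k3.join k2
    (by
      rintro x ⟨hx | hx, hx'⟩
      · exact hx
      · exact Or.inl (hinter x hx hx'))
    (by
      rintro x ⟨hx | hx, hx'⟩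
      · rcases hx with hx | hx
        · exact hx
        · exact hinter x (Or.inl (Or.inr (s1 hx))) hx'
      · exact hinter x hx hx')
  have hS : ({u, w, v} ∪ touching G B O ∪ touching G A B ∪ touching G A O ∪
      ({u, w, v} ∪ touching G A (Set.Icc u w)ᶜ ∪ Set.Icc u w)) ∪
      ({u, w, v} ∪ touching G B (Set.Icc w v)ᶜ ∪ Set.Icc w v ∪ touching G A B) =
      Set.Icc u v := by
    have r0 : ({u, w, v} : Set V) ⊆ Set.Icc u v := by
      rintro x (rfl | rfl | rfl)
      · exact ⟨le_rfl, (huw.trans hwv).le⟩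
      · exact ⟨huw.le, hwv.le⟩
      · exact ⟨(huw.trans hwv).le, le_rfl⟩
    have r1 : ∀ X, touching G A X ⊆ Set.Icc u v :=
      fun X => ((hTA X).trans hAO).trans Set.Ioo_subset_Icc_self
    have r2 : ∀ X, touching G B X ⊆ Set.Icc u v :=
      fun X => ((hTB X).trans hBO).trans Set.Ioo_subset_Icc_self
    refine Set.Subset.antisymm ?_ ?_
    · simp only [Set.union_subset_iff, r0, r1, r2, true_and, and_true]
      exact ⟨Set.Icc_subset_Icc_right hwv.le, Set.Icc_subset_Icc_left huw.le⟩
    · intro x hx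
      rcases le_total x w with h | h
      · exact Or.inl (Or.inr (Or.inr ⟨hx.1, h⟩))
      · exact Or.inr (Or.inl (Or.inr ⟨h, hx.2⟩))
  rw [hS] at k4
  refine k4.mono ?_ ?_
  · have hin : ∀ a ∈ Set.Icc u v, ∀ b ∈ Set.Icc u v, G.Adj a b → a < b →
        (a ∈ Set.Icc u w ∧ b ∈ Set.Icc u w) ∨ (a ∈ Set.Icc w v ∧ b ∈ Set.Icc w v) ∨
        (a ∈ ({u, w, v} : Set V) ∪ touching G A (Set.Icc u w)ᶜ ∧
          b ∈ ({u, w, v} : Set V) ∪ touching G A (Set.Icc u w)ᶜ) ∨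
        (a ∈ ({u, w, v} : Set V) ∪ touching G B (Set.Icc w v)ᶜ ∧
          b ∈ ({u, w, v} : Set V) ∪ touching G B (Set.Icc w v)ᶜ) ∨ (a ∈ A ∧ b ∈ B) := by
      intro a ha b hb hab hlt
      rcases le_or_gt b w with hbw | hbw
      · exact Or.inl ⟨⟨ha.1, hlt.le.trans hbw⟩, hb.1, hbw⟩
      rcases le_or_gt w a with haw | haw
      · exact Or.inr (Or.inl ⟨⟨haw, ha.2⟩, hbw.le, hb.2⟩)
      rcases ha.1.eq_or_lt with rfl | hua <;> rcases hb.2.eq_or_lt with rfl | hbv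
      · exact Or.inr (Or.inr (Or.inl (by simp)))
      · exact Or.inr (Or.inr (Or.inr (Or.inl ⟨by simp, Or.inr ⟨⟨hbw, hbv⟩, _,
          fun h => absurd h.1 (not_le.2 huw), hab.symm⟩⟩)))
      · exact Or.inr (Or.inr (Or.inl ⟨Or.inr ⟨⟨hua, haw⟩, _,
          fun h => absurd h.2 (not_le.2 hwv), hab⟩, by simp⟩))
      · exact Or.inr (Or.inr (Or.inr (Or.inr ⟨⟨hua, haw⟩, hbw, hbv⟩)))
    rintro a b ⟨ha, hb, hab⟩
    rcases hab.ne.lt_or_gt with hlt | hlt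
    · rcases hin a ha b hb hab hlt with h | h | h | h | h
      · exact Or.inl (Or.inl (Or.inl ⟨h.1, h.2, hab⟩))
      · exact Or.inr (Or.inl (Or.inl ⟨h.1, h.2, hab⟩))
      · exact Or.inl (Or.inl (Or.inr h))
      · exact Or.inr (Or.inl (Or.inr h))
      · exact Or.inr (Or.inr (Or.inl ⟨h.1, h.2, hab⟩))
    · rcases hin b hb a ha hab.symm hlt with h | h | h | h | h
      · exact Or.inl (Or.inl (Or.inl ⟨h.2, h.1, hab⟩))
      · exact Or.inr (Or.inl (Or.inl ⟨h.2, h.1, hab⟩))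
      · exact Or.inl (Or.inl (Or.inr h.symm))
      · exact Or.inr (Or.inl (Or.inr h.symm))
      · exact Or.inr (Or.inr (Or.inr ⟨h.1, h.2, hab⟩))
  · rintro x ((rfl | rfl) | ⟨hx, y, hy, hxy⟩)
    · simp
    · simp
    · rcases lt_trichotomy x w with h | rfl | h
      · exact Or.inr ⟨⟨hx.1, h⟩, y, hy, hxy⟩
      · simp
      · exact Or.inl (Or.inl (Or.inr ⟨⟨h, hx.2⟩, y, hy, hxy⟩))

lemma hasDecomp_Icc (hG : InterleaveBound G (j + 1)) {u v : V} (huv : u < v)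
    (hc : (chordCrossings G u v).ncard ≤ 2 * j + 1) :
    HasDecomp (fun a b => a ∈ Set.Icc u v ∧ b ∈ Set.Icc u v ∧ G.Adj a b) (3 * j + 5)
      (Set.Icc u v) ({u, v} ∪ touching G (Set.Ioo u v) (Set.Icc u v)ᶜ) := by
  -- The apex lies on neither new side's interior, so both sides have fewer vertices behind them.
  induction hm : (Set.Ioo u v).ncard using Nat.strong_induction_on generalizing u v with
  | _ m ih =>
    subst hm
    rcases (Set.Ioo u v).eq_empty_or_nonempty with he | hne
    · have hI : Set.Icc u v = {u, v} := by
        ext x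
        have : x ∉ Set.Ioo u v := by simp [he]
        simp only [Set.mem_Icc, Set.mem_Ioo, Set.mem_insert_iff, Set.mem_singleton_iff] at *
        constructor
        · rintro ⟨h1, h2⟩
          rcases h1.eq_or_lt with rfl | h1
          · exact Or.inl rfl
          · exact Or.inr (h2.eq_of_not_lt fun h => this ⟨h1, h⟩)
        · rintro (rfl | rfl)
          · exact ⟨le_rfl, huv.le⟩
          · exact ⟨huv.le, le_rfl⟩
      have hT : touching G (Set.Ioo u v) (Set.Icc u v)ᶜ = ∅ :=
        Set.subset_empty_iff.1 (touching_subset.trans he.subset)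
      rw [hT, Set.union_empty, hI]
      refine (HasDecomp.single ?_).mono (fun a b h => ⟨h.1, h.2.1⟩) subset_rfl
      have := Set.ncard_pair huv.ne
      omega
    · obtain ⟨w, huw, hwv, h1, h2⟩ := exists_split hG hc hne
      refine hasDecomp_triangle huw hwv hc h1 h2 (ih _ ?_ huw h1 rfl) (ih _ ?_ hwv h2 rfl)
      · refine Set.ncard_lt_ncard ⟨Set.Ioo_subset_Ioo_right hwv.le, fun h => ?_⟩ (Set.toFinite _)
        exact lt_irrefl w (h ⟨huw, hwv⟩).2
      · refine Set.ncard_lt_ncard ⟨Set.Ioo_subset_Ioo_left huw.le, fun h => ?_⟩ (Set.toFinite _)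
        exact lt_irrefl w (h ⟨huw, hwv⟩).1

lemma treewidth_le_of_interleaveBound (hG : InterleaveBound G (j + 1)) :
    treewidth G ≤ ((3 * j + 4 : ℕ) : ℕ∞) := by
  rcases subsingleton_or_nontrivial V with hV | hV
  · have hcard : (Set.univ : Set V).ncard ≤ 3 * j + 4 + 1 := by
      have := Set.ncard_le_one_of_subsingleton (Set.univ : Set V)
      omega
    exact ((HasDecomp.single hcard).mono (fun _ _ _ => ⟨trivial, trivial⟩) subset_rfl).treewidth_le
  · obtain ⟨u, hu⟩ := Finite.exists_min (id : V → V)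
    obtain ⟨v, hv⟩ := Finite.exists_max (id : V → V)
    have huv : u < v := by
      obtain ⟨a, b, hab⟩ := hV
      rcases hab.lt_or_gt with h | h
      · exact ((hu a).trans_lt h).trans_le (hv b)
      · exact ((hu b).trans_lt h).trans_le (hv a)
    have hI : Set.Icc u v = Set.univ := Set.eq_univ_of_forall fun x => ⟨hu x, hv x⟩
    -- The chord from the first to the last vertex has nothing outside it, so no edge crosses it.
    have hc : (chordCrossings G u v).ncard ≤ 2 * j + 1 := by
      rw [chordCrossings, ncard_edgesBetween_eq_zero]
      · exact Nat.zero_le _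
      · intro a _ b hb
        simp [hI] at hb
    have h := hasDecomp_Icc hG huv hc
    rw [hI] at h
    exact (h.mono (fun a b hab => ⟨trivial, trivial, hab⟩) subset_rfl).treewidth_le

end triangulation

/-! ### Interleaving chords of a circle meet. -/

section circle

/-- Twice the signed area of the triangle spanned by three points of the unit circle, given by their
angles. -/
noncomputable def chordArea (a b c : ℝ) : ℝ :=
  Real.sin (b - a) + Real.sin (c - b) - Real.sin (c - a)

lemma chordArea_pos {a b c : ℝ} (hab : a < b) (hbc : b < c) (hca : c < a + 2 * Real.pi) :
    0 < chordArea a b c := by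
  have h : chordArea a b c =
      4 * (Real.sin ((b - a) / 2) * Real.sin ((c - b) / 2) * Real.sin ((c - a) / 2)) := by
    obtain ⟨x, hx⟩ : ∃ x, x = (b - a) / 2 := ⟨_, rfl⟩
    obtain ⟨y, hy⟩ : ∃ y, y = (c - b) / 2 := ⟨_, rfl⟩
    have h1 : b - a = 2 * x := by linarith
    have h2 : c - b = 2 * y := by linarith
    have h3 : c - a = 2 * (x + y) := by linarith
    rw [chordArea, h1, h2, h3]
    simp only [mul_div_cancel_left₀ _ (two_ne_zero' ℝ), Real.sin_two_mul, Real.sin_add,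
      Real.cos_add]
    have h4 := Real.sin_sq_add_cos_sq x
    have h5 := Real.sin_sq_add_cos_sq y
    linear_combination (-2 * Real.sin x * Real.cos x) * h5 - 2 * Real.sin y * Real.cos y * h4
  rw [h]
  have h1 : 0 < Real.sin ((b - a) / 2) := Real.sin_pos_of_pos_of_lt_pi (by linarith) (by linarith)
  have h2 : 0 < Real.sin ((c - b) / 2) := Real.sin_pos_of_pos_of_lt_pi (by linarith) (by linarith)
  have h3 : 0 < Real.sin ((c - a) / 2) := Real.sin_pos_of_pos_of_lt_pi (by linarith) (by linarith)
  positivity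

/-- Chords of a circle whose ends interleave meet in an interior point. -/
lemma openSegment_inter_nonempty {p q s t o : EuclideanSpace ℝ (Fin 2)} {r a b c d : ℝ}
    (hab : a < b) (hbc : b < c) (hcd : c < d) (hda : d < a + 2 * Real.pi)
    (hp : p 0 = o 0 + r * Real.cos a ∧ p 1 = o 1 + r * Real.sin a)
    (hq : q 0 = o 0 + r * Real.cos b ∧ q 1 = o 1 + r * Real.sin b)
    (hs : s 0 = o 0 + r * Real.cos c ∧ s 1 = o 1 + r * Real.sin c)
    (ht : t 0 = o 0 + r * Real.cos d ∧ t 1 = o 1 + r * Real.sin d) :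
    (openSegment ℝ p s ∩ openSegment ℝ q t).Nonempty := by
  have h1 : 0 < chordArea b c d := chordArea_pos hbc hcd (by linarith)
  have h2 : 0 < chordArea a b d := chordArea_pos hab (hbc.trans hcd) hda
  have h3 : 0 < chordArea a c d := chordArea_pos (hab.trans hbc) hcd hda
  have h4 : 0 < chordArea a b c := chordArea_pos hab hbc (by linarith)
  have hsum : chordArea a c d + chordArea a b c = chordArea b c d + chordArea a b d := by
    unfold chordArea
    ring
  have hne : chordArea b c d + chordArea a b d ≠ 0 := by positivity
  -- The meeting point weights each end of a diagonal by the area of the triangle on the other three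
  -- points; `hsum` is the area of the quadrilateral, cut along either diagonal.
  refine ⟨(chordArea b c d / (chordArea b c d + chordArea a b d)) • p +
    (chordArea a b d / (chordArea b c d + chordArea a b d)) • s,
    ⟨_, _, by positivity, by positivity, by rw [← add_div, div_self hne], rfl⟩,
    ⟨chordArea a c d / (chordArea b c d + chordArea a b d),
      chordArea a b c / (chordArea b c d + chordArea a b d), by positivity, by positivity,
      by rw [← add_div, hsum, div_self hne], ?_⟩⟩
  ext i
  fin_cases i
  · simp only [Fin.zero_eta, PiLp.add_apply, PiLp.smul_apply, smul_eq_mul, hp.1, hq.1, hs.1, ht.1]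
    field_simp
    simp only [chordArea, Real.sin_sub]
    ring
  · simp only [Fin.mk_one, PiLp.add_apply, PiLp.smul_apply, smul_eq_mul, hp.2, hq.2, hs.2, ht.2]
    field_simp
    simp only [chordArea, Real.sin_sub]
    ring

end circle

/-! ### From the drawing to the order by angle. -/

namespace ConvexDrawing

variable {V : Type*} (Γ : ConvexDrawing V)

/-- The angle at which a vertex is placed on the circle. -/
noncomputable def angle (v : V) : ℝ :=
  Complex.arg ⟨Γ.pos v 0 - Γ.center 0, Γ.pos v 1 - Γ.center 1⟩

lemma pos_eq (v : V) : Γ.pos v 0 = Γ.center 0 + Γ.radius * Real.cos (Γ.angle v) ∧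
    Γ.pos v 1 = Γ.center 1 + Γ.radius * Real.sin (Γ.angle v) := by
  have hn : ‖(⟨Γ.pos v 0 - Γ.center 0, Γ.pos v 1 - Γ.center 1⟩ : ℂ)‖ = Γ.radius := by
    have h := Γ.pos_mem v
    rw [mem_sphere_iff_norm, EuclideanSpace.norm_eq, Fin.sum_univ_two] at h
    rw [← h, Complex.norm_def, Complex.normSq_apply]
    simp [sq]
  have h1 := Complex.norm_mul_cos_arg (⟨Γ.pos v 0 - Γ.center 0, Γ.pos v 1 - Γ.center 1⟩ : ℂ)
  have h2 := Complex.norm_mul_sin_arg (⟨Γ.pos v 0 - Γ.center 0, Γ.pos v 1 - Γ.center 1⟩ : ℂ)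
  rw [hn] at h1 h2
  simp only at h1 h2
  constructor
  · rw [angle, h1]
    ring
  · rw [angle, h2]
    ring

lemma angle_injective : Function.Injective Γ.angle := by
  intro u v h
  apply Γ.pos_injective
  ext i
  fin_cases i
  · exact ((Γ.pos_eq u).1.trans (by rw [h])).trans (Γ.pos_eq v).1.symm
  · exact ((Γ.pos_eq u).2.trans (by rw [h])).trans (Γ.pos_eq v).2.symm

variable {Γ} {G : SimpleGraph V} {k : ℕ}

lemma Cross.symm {e f : Sym2 V} (h : Γ.Cross e f) : Γ.Cross f e :=
  ⟨h.1.symm, by rw [Set.inter_comm]; exact h.2⟩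

lemma cross_of_interleave {a b c d : V} (hac : Γ.angle a < Γ.angle c) (hcb : Γ.angle c < Γ.angle b)
    (hbd : Γ.angle b < Γ.angle d) : Γ.Cross s(a, b) s(c, d) := by
  refine ⟨fun h => ?_, openSegment_inter_nonempty hac hcb hbd ?_ (Γ.pos_eq a) (Γ.pos_eq c)
    (Γ.pos_eq b) (Γ.pos_eq d)⟩
  · rcases Sym2.eq_iff.1 h with ⟨rfl, rfl⟩ | ⟨rfl, rfl⟩
    · exact lt_irrefl _ hac
    · exact lt_irrefl _ hcb
  -- The half-open range of the argument keeps all angles within less than one full turn.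
  · have h1 : -Real.pi < Γ.angle a := Complex.neg_pi_lt_arg _
    have h2 : Γ.angle d ≤ Real.pi := Complex.arg_le_pi _
    linarith

/-- The vertices, ordered by their angles. -/
noncomputable abbrev angleOrder (Γ : ConvexDrawing V) : LinearOrder V :=
  LinearOrder.lift' Γ.angle Γ.angle_injective

/-- Interleaving implies crossing, so the combinatorial count never exceeds the geometric one; the
converse is not needed. -/
lemma ncard_chordCrossings_le [Finite V] {a b : V}
    (h : Γ.crossings G s(a, b) ≤ (k : ℕ∞)) :
    (@chordCrossings V Γ.angleOrder G a b).ncard ≤ k := by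
  let := Γ.angleOrder
  have hlt : ∀ {x y : V}, x < y → Γ.angle x < Γ.angle y := fun h => h
  have hsub : chordCrossings G a b ⊆ {f : Sym2 V | f ∈ G.edgeSet ∧ Γ.Cross s(a, b) f} := by
    rintro f ⟨x, hx, y, hy, hxy, rfl⟩
    refine ⟨hxy, ?_⟩
    have hy' : y < a ∨ b < y := by
      by_contra hcon
      push Not at hcon
      exact hy hcon
    rcases hy' with hy' | hy'
    · rw [Sym2.eq_swap (a := x)]
      exact (cross_of_interleave (hlt hy') (hlt hx.1) (hlt hx.2)).symm
    · exact cross_of_interleave (hlt hx.1) (hlt hx.2) (hlt hy')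
  have h1 := (Set.encard_le_encard hsub).trans h
  rw [← (Set.toFinite (chordCrossings G a b)).cast_ncard_eq] at h1
  exact_mod_cast h1

lemma interleaveBound [Finite V]
    (h : ∀ e ∈ G.edgeSet, ∀ f ∈ G.edgeSet, Γ.Cross e f →
      Γ.crossings G e ≤ (k : ℕ∞) ∨ Γ.crossings G f ≤ (k : ℕ∞)) :
    @InterleaveBound V Γ.angleOrder G k :=
  fun _ _ _ _ hac hcb hbd hab hcd =>
    (h _ hab _ hcd (cross_of_interleave hac hcb hbd)).imp ncard_chordCrossings_le
      ncard_chordCrossings_le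

end ConvexDrawing

end ConvexGraphDrawing

theorem mainTheorem4 {V : Type*} [Finite V] (G : SimpleGraph V) (k : ℕ) (hk : 1 ≤ k)
    (hG : ConvexGraphDrawing.IsOuterMinPlanar k G) :
    ConvexGraphDrawing.treewidth G ≤ ((3 * k + 1 : ℕ) : ℕ∞) := by
  -- The threshold 2k − 1 becomes 2j + 1, without truncated subtraction.
  obtain ⟨j, rfl⟩ : ∃ j, k = j + 1 := ⟨k - 1, by omega⟩
  obtain ⟨Γ, hΓ⟩ := hG
  let := Γ.angleOrder
  exact ConvexGraphDrawing.treewidth_le_of_interleaveBound (Γ.interleaveBound hΓ)
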